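/- Let $q \in \{2,3\}$, let $n \ge 4$ be even, and let $F_q$ be the field with $q$ elements. Let $G = GL_n(q) \rtimes \langle \tau \rangle$, where $\tau$ is the automorphism $A \mapsto (A^{-1})^{T}$ of $GL_n(q)$. Let $v_1,\dots,v_n$ be the standard basis of the space $F_q^n$ of row vectors, on which $GL_n(q)$ acts by right multiplication, and let $P \le GL_n(q)$ be the stabilizer of the chain of subspaces $$\langle v_n, v_{n-1}\rangle < \langle v_n, v_{n-1}, v_{n-2}, v_{n-3}\rangle < \dots < \langle v_n, v_{n-1}, \dots, v_2, v_1\rangle,$$ that is, the group of all $A \in GL_n(q)$ that map each of these subspaces onto itself. Let $H = N_G(P)$ be the normalizer of $P$ in $G$, let $H_G = \bigcap_{g \in G} H^g$, and let $\Omega$ be the set of cosets of $H$ in $G$, on which $G/H_G$ acts faithfully and transitively by multiplication. Denote by $Reg_H(G,m)$ the number of regular orbits of $G/H_G$ on $\Omega^m$ with the diagonal action, i.e. the number of orbits of $m$-tuples whose stabilizer in $G/H_G$ is trivial. Then $$Reg_H(G,5) \ge 5.$$ -/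

import Mathlib

/-! ### Regular orbits -/

/-- `Reg(G, m)`: the number of regular orbits of `G` on `Ω^m` (with the diagonal action),
i.e. of orbits of `m`-tuples whose stabilizer in `G` is trivial. -/
noncomputable def numRegularOrbits (G Ω : Type*) [Group G] [MulAction G Ω] (m : ℕ) : ℕ :=
  Set.ncard {O : Set (Fin m → Ω) |
    ∃ x : Fin m → Ω, MulAction.stabilizer G x = ⊥ ∧ O = MulAction.orbit G x}

/-- The action of `G / H_G` on the cosets of `H` induced by the action of `G`, where
`H_G = ⋂ g, H ^ g` is the normal core of `H`. -/
@[reducible] def coreQuotientAction {G : Type*} [Group G] (H : Subgroup G) :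
    MulAction (G ⧸ H.normalCore) (G ⧸ H) :=
  MulAction.compHom (G ⧸ H)
    (QuotientGroup.lift H.normalCore (MulAction.toPermHom G (G ⧸ H))
      (fun g hg => by
        have h := H.normalCore_eq_ker
        rw [h] at hg
        exact hg))

theorem coreQuotientAction_mk_smul {G : Type*} [Group G] (H : Subgroup G) (g : G) (x : G ⧸ H) :
    (coreQuotientAction H).toSMul.smul (QuotientGroup.mk g) x = g • x := rfl

/-- `Reg_H(G, m) = Reg(G / H_G, m)`, for `G / H_G` acting on the cosets of `H`. -/
noncomputable def regOnCosets {G : Type*} [Group G] (H : Subgroup G) (m : ℕ) : ℕ :=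
  letI := coreQuotientAction H
  numRegularOrbits (G ⧸ H.normalCore) (G ⧸ H) m

/-! ### The group `GL_n(q) ⋊ ⟨τ⟩` -/

/-- The inverse-transpose automorphism `τ : A ↦ (A⁻¹)ᵀ` of `GL_n(F)`. -/
def inverseTranspose (n : ℕ) (F : Type*) [Field F] :
    MulAut (Matrix.GeneralLinearGroup (Fin n) F) where
  toFun A :=
    { val := (A⁻¹).val.transpose
      inv := A.val.transpose
      val_inv := by rw [← Matrix.transpose_mul, Units.mul_inv, Matrix.transpose_one]
      inv_val := by rw [← Matrix.transpose_mul, Units.inv_mul, Matrix.transpose_one] }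
  invFun A :=
    { val := (A⁻¹).val.transpose
      inv := A.val.transpose
      val_inv := by rw [← Matrix.transpose_mul, Units.mul_inv, Matrix.transpose_one]
      inv_val := by rw [← Matrix.transpose_mul, Units.inv_mul, Matrix.transpose_one] }
  left_inv A := Units.ext (Matrix.transpose_transpose A.val)
  right_inv A := Units.ext (Matrix.transpose_transpose A.val)
  map_mul' A B := Units.ext (by
    change ((A * B)⁻¹).val.transpose = (A⁻¹).val.transpose * (B⁻¹).val.transpose
    rw [mul_inv_rev, Units.val_mul, Matrix.transpose_mul])

/-- The semidirect product `GL_n(F) ⋊ ⟨τ⟩`, with `⟨τ⟩` the group of automorphisms of `GL_n(F)`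
generated by the inverse-transpose automorphism `τ`. -/
abbrev GLTau (n : ℕ) (F : Type*) [Field F] : Type _ :=
  SemidirectProduct (Matrix.GeneralLinearGroup (Fin n) F)
    (Subgroup.zpowers (inverseTranspose n F)) (Subgroup.zpowers (inverseTranspose n F)).subtype

/-! ### The flag stabilizer and its normalizer -/

/-- The subspace `⟨v_n, v_{n-1}, …, v_{n-2j+1}⟩` of `F^n` spanned by the last `2j` vectors of the
standard basis `v_1, …, v_n`. (The vector `v_{i+1}` is `Pi.single i 1` for `i : Fin n`.) -/
def flagSubspace (n : ℕ) (F : Type*) [Field F] (j : ℕ) : Submodule F (Fin n → F) :=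
  Submodule.span F {v | ∃ i : Fin n, n ≤ (i : ℕ) + 2 * j ∧ v = Pi.single i 1}

/-- The subgroup `P` of `GL_n(F)` stabilizing each subspace of the chain
`⟨v_n, v_{n-1}⟩ < ⟨v_n, …, v_{n-3}⟩ < … < ⟨v_n, …, v_1⟩`, where matrices act on row vectors
from the right. -/
def flagStabilizer (n : ℕ) (F : Type*) [Field F] :
    Subgroup (Matrix.GeneralLinearGroup (Fin n) F) where
  carrier := {A | ∀ j : ℕ, 1 ≤ j → 2 * j ≤ n →
    (flagSubspace n F j).map (Matrix.vecMulLinear A.val) = flagSubspace n F j}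
  one_mem' j _ _ := by
    have h : Matrix.vecMulLinear (1 : Matrix (Fin n) (Fin n) F) = LinearMap.id := by
      ext; simp
    rw [Units.val_one, h, Submodule.map_id]
  mul_mem' {A B} hA hB j h1 h2 := by
    have h : Matrix.vecMulLinear (A.val * B.val)
        = (Matrix.vecMulLinear B.val).comp (Matrix.vecMulLinear A.val) := by
      refine LinearMap.ext fun v => ?_
      simp [Matrix.vecMul_vecMul]
    rw [Units.val_mul, h, Submodule.map_comp, hA j h1 h2, hB j h1 h2]
  inv_mem' {A} hA j h1 h2 := by
    have h : (Matrix.vecMulLinear (A⁻¹).val).comp (Matrix.vecMulLinear A.val)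
        = LinearMap.id := by
      refine LinearMap.ext fun v => ?_
      change Matrix.vecMul (Matrix.vecMul v A.val) (A⁻¹).val = v
      rw [Matrix.vecMul_vecMul, Units.mul_inv, Matrix.vecMul_one]
    calc (flagSubspace n F j).map (Matrix.vecMulLinear (A⁻¹).val)
        = ((flagSubspace n F j).map (Matrix.vecMulLinear A.val)).map
            (Matrix.vecMulLinear (A⁻¹).val) := by rw [hA j h1 h2]
      _ = flagSubspace n F j := by rw [← Submodule.map_comp, h, Submodule.map_id]

/-- The normalizer `H = N_G(P)` of `P` in `G = GL_n(F) ⋊ ⟨τ⟩`, where `P ≤ GL_n(F)` is viewed as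
a subgroup of `G`. -/
def flagNormalizer (n : ℕ) (F : Type*) [Field F] : Subgroup (GLTau n F) :=
  Subgroup.normalizer
    (((flagStabilizer n F).map SemidirectProduct.inl : Subgroup (GLTau n F)) : Set (GLTau n F))

/-! ### Block triangular matrices: the flag stabilizer is self-normalizing in the general linear
group -/

section BlockTriangular

variable {n : ℕ} {F : Type*} [Field F]

/-! It suffices to find one regular 5-tuple with a distinguished entry: an invariant relation
("opposite") holds from one entry to all the others, while every other entry fails it with some
entry. Moving the distinguished entry to each of the five positions then gives five different
regular orbits (`le_numRegularOrbits_of_unique`).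

Let `w` be the reversal matrix, and attach to `h` the coset of `h⁻¹`, i.e. the flag spanned by the
last rows of `h`. The tuple consists of the flags of `1`, `w` and three matrices `1 + N`, with `N`
supported in the last two rows and the first `n - 2` columns.

An element `A` of `GL_n` fixing all five is central. The flags of `1` and `w` make `A` block
diagonal, and then each `1 + N` forces `A` to commute with `N`. For `N = sumRows` this makes all
diagonal blocks equal, and two matrix units make the first block scalar. Central elements lie in the
core.

An element `Mτ` fixes the flag of `h` only if `h M hᵀ` vanishes at positions in blocks `a, b`
(counted from 0) with `a + b ≥ n / 2`. The flags of `1` and of the two matrix units kill the last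
column of `M`, which is absurd.

The flag of `w` is opposite to the other four. Two flags `1 + N`, `1 + N'` are not opposite as soon
as `N - N'` has a row among the last two vanishing in the first two columns. -/

theorem mem_flagSubspace {j : ℕ} {v : Fin n → F} :
    v ∈ flagSubspace n F j ↔ ∀ i : Fin n, (i : ℕ) + 2 * j < n → v i = 0 := by
  constructor
  · intro hv i hi
    induction hv using Submodule.span_induction with
    | mem x hx =>
      obtain ⟨k, hk, rfl⟩ := hx
      have : i ≠ k := by rintro rfl; omega
      simp [this]
    | zero => rfl
    | add x y _ _ hx hy => simp [hx, hy]
    | smul a x _ hx => simp [hx]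
  · intro h
    rw [pi_eq_sum_univ' v]
    refine Submodule.sum_mem _ fun i _ => ?_
    by_cases hi : (i : ℕ) + 2 * j < n
    · simp [h i hi]
    · refine Submodule.smul_mem _ _ (Submodule.subset_span ⟨i, by omega, ?_⟩)
      ext k
      simp [Pi.single_apply, eq_comm]

/-- The block of size two to which an index belongs. -/
def pairBlock (n : ℕ) (i : Fin n) : ℕ := (i : ℕ) / 2

theorem vecMulLinear_injective (A : Matrix.GeneralLinearGroup (Fin n) F) :
    Function.Injective (Matrix.vecMulLinear A.val) := by
  intro v w h
  have h' : Matrix.vecMul v A.val = Matrix.vecMul w A.val := h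
  have := congrArg (fun u => Matrix.vecMul u (A⁻¹).val) h'
  simpa only [Matrix.vecMul_vecMul, Units.mul_inv, Matrix.vecMul_one] using this

theorem mem_flagStabilizer (hn : Even n) {A : Matrix.GeneralLinearGroup (Fin n) F} :
    A ∈ flagStabilizer n F ↔ A.val.BlockTriangular (pairBlock n) := by
  constructor
  · intro hA k l hkl
    simp only [pairBlock] at hkl
    obtain ⟨m, rfl⟩ := hn
    have hk := k.2
    have h := hA (m - (k : ℕ) / 2) (by omega) (by omega)
    have hmem : (Pi.single k 1 : Fin (m + m) → F) ∈ flagSubspace (m + m) F (m - (k : ℕ) / 2) :=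
      Submodule.subset_span ⟨k, by omega, rfl⟩
    have h2 := Submodule.mem_map_of_mem (f := Matrix.vecMulLinear A.val) hmem
    rw [h, mem_flagSubspace] at h2
    simpa using h2 l (by omega)
  · intro hA j _ hj
    refine Submodule.eq_of_le_of_finrank_eq ?_ ?_
    · rintro _ ⟨v, hv, rfl⟩
      rw [SetLike.mem_coe, mem_flagSubspace] at hv
      rw [mem_flagSubspace]
      intro l hl
      rw [Matrix.vecMulLinear_apply, Matrix.vecMul, dotProduct]
      refine Finset.sum_eq_zero fun k _ => ?_
      by_cases hk : (k : ℕ) + 2 * j < n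
      · rw [hv k hk, zero_mul]
      · obtain ⟨m, rfl⟩ := hn
        rw [hA (show pairBlock _ l < pairBlock _ k by simp only [pairBlock]; omega), mul_zero]
    · exact (Submodule.equivMapOfInjective _ (vecMulLinear_injective A) _).finrank_eq.symm

/-- Apply the hypothesis to the transvection `1 + E_ij` and subtract the identity. -/
theorem single_conj_blockTriangular (hn : Even n) {B : Matrix.GeneralLinearGroup (Fin n) F}
    (hB : ∀ p ∈ flagStabilizer n F, B * p * B⁻¹ ∈ flagStabilizer n F) {i j : Fin n}
    (hij : pairBlock n i ≤ pairBlock n j) (hne : i ≠ j) :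
    (B.val * Matrix.single i j 1 * (B⁻¹).val).BlockTriangular (pairBlock n) := by
  let p : Matrix.GeneralLinearGroup (Fin n) F :=
    { val := Matrix.transvection i j 1
      inv := Matrix.transvection i j (-1)
      val_inv := by rw [Matrix.transvection_mul_transvection_same _ _ hne]; simp
      inv_val := by rw [Matrix.transvection_mul_transvection_same _ _ hne]; simp }
  have hp : p ∈ flagStabilizer n F :=
    (mem_flagStabilizer hn).2 (Matrix.blockTriangular_transvection hij 1)
  have h := (mem_flagStabilizer hn).1 (hB p hp)
  have hval : (B * p * B⁻¹).val = 1 + B.val * Matrix.single i j 1 * (B⁻¹).val := by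
    change B.val * (1 + Matrix.single i j 1) * (B⁻¹).val = _
    rw [mul_add, mul_one, add_mul, Units.mul_inv]
  rw [hval] at h
  have := h.sub (Matrix.blockTriangular_one (b := pairBlock n) (R := F))
  simpa using this

/-- If `B k i ≠ 0` below the diagonal blocks, the entries `B k i * B⁻¹ j l` of the conjugates of
`E_ij` force zeros in `B⁻¹`; then `B⁻¹` would embed a member of the flag into a strictly smaller
one. -/
theorem mem_flagStabilizer_of_conj (hn : Even n) {B : Matrix.GeneralLinearGroup (Fin n) F}
    (hB : ∀ p ∈ flagStabilizer n F, B * p * B⁻¹ ∈ flagStabilizer n F) :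
    B ∈ flagStabilizer n F := by
  rw [mem_flagStabilizer hn]
  have key : ∀ i j : Fin n, pairBlock n i ≤ pairBlock n j →
      (B.val * Matrix.single i j 1 * (B⁻¹).val).BlockTriangular (pairBlock n) := by
    intro i j hij
    by_cases hne : i = j
    · subst hne
      -- `E_ii` does not come from a transvection, but `E_ii = E_ii' E_i'i` with `i'` the other
      -- index of the block.
      obtain ⟨i', hi', hne⟩ : ∃ i' : Fin n, pairBlock n i' = pairBlock n i ∧ i ≠ i' := by
        obtain ⟨m, rfl⟩ := hn
        have hi := i.2
        refine ⟨⟨2 * ((i : ℕ) / 2) + (1 - (i : ℕ) % 2), by omega⟩, ?_, ?_⟩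
        · simp only [pairBlock]; omega
        · intro h
          have := congrArg Fin.val h
          simp only at this
          omega
      have h := (single_conj_blockTriangular hn hB hi'.ge hne).mul
        (single_conj_blockTriangular hn hB hi'.le hne.symm)
      have e : B.val * Matrix.single i i' 1 * (B⁻¹).val *
          (B.val * Matrix.single i' i 1 * (B⁻¹).val)
          = B.val * Matrix.single i i 1 * (B⁻¹).val := by
        calc _ = B.val * Matrix.single i i' 1 * ((B⁻¹).val * B.val) *
              Matrix.single i' i 1 * (B⁻¹).val := by simp only [mul_assoc]
          _ = B.val * (Matrix.single i i' 1 * Matrix.single i' i 1) * (B⁻¹).val := by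
              rw [Units.inv_mul, mul_one]; simp only [mul_assoc]
          _ = _ := by rw [Matrix.single_mul_single_same, one_mul]
      rwa [e] at h
    · exact single_conj_blockTriangular hn hB hij hne
  intro k i hki
  by_contra hne
  have hC : ∀ j l : Fin n, pairBlock n i ≤ pairBlock n j → pairBlock n l < pairBlock n k →
      (B⁻¹).val j l = 0 := by
    intro j l hj hl
    have h := key i j hj hl
    rw [Matrix.mul_assoc, Matrix.mul_apply, Finset.sum_eq_single i] at h
    · simpa [hne] using h
    · intro t _ ht
      simp [Matrix.single_mul_apply_of_ne, ht]
    · simp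
  let W : ℕ → Submodule F (Fin n → F) := fun c =>
    { carrier := {v | ∀ l : Fin n, pairBlock n l < c → v l = 0}
      add_mem' := fun ha hb l hl => by simp [ha l hl, hb l hl]
      zero_mem' := fun _ _ => rfl
      smul_mem' := fun c v hv l hl => by simp [hv l hl] }
  have h1 : (W (pairBlock n i)).map (Matrix.vecMulLinear (B⁻¹).val) ≤ W (pairBlock n k) := by
    rintro _ ⟨v, hv, rfl⟩ l hl
    rw [Matrix.vecMulLinear_apply, Matrix.vecMul, dotProduct]
    refine Finset.sum_eq_zero fun j _ => ?_
    by_cases hj : pairBlock n j < pairBlock n i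
    · rw [hv j hj, zero_mul]
    · rw [hC j l (not_lt.1 hj) hl, mul_zero]
  have h2 : W (pairBlock n k) < W (pairBlock n i) := by
    refine lt_of_le_of_ne (fun v hv l hl => hv l (hl.trans hki)) fun h => ?_
    have hi : (Pi.single i 1 : Fin n → F) ∈ W (pairBlock n i) := by
      intro l hl
      have : l ≠ i := by rintro rfl; exact lt_irrefl _ hl
      simp [this]
    rw [← h] at hi
    simpa using hi i hki
  have h3 := Submodule.finrank_mono h1
  rw [← (Submodule.equivMapOfInjective _ (vecMulLinear_injective B⁻¹) _).finrank_eq] at h3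
  exact absurd (Submodule.finrank_lt_finrank_of_lt h2) (not_lt.2 h3)

end BlockTriangular

/-! ### The reversal matrix and the two cosets of `GL_n` in the extended group -/

section Reversal

variable {n : ℕ} {F : Type*} [Field F]

/-- The permutation matrix of the order reversal of the standard basis. -/
def reversal (n : ℕ) (F : Type*) [Field F] : Matrix.GeneralLinearGroup (Fin n) F where
  val := (1 : Matrix (Fin n) (Fin n) F).submatrix Fin.revPerm id
  inv := (1 : Matrix (Fin n) (Fin n) F).submatrix Fin.revPerm id
  val_inv := by
    ext i j
    rw [Matrix.mul_apply, Finset.sum_eq_single i.rev] <;>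
      simp +contextual [Matrix.one_apply, eq_comm]
  inv_val := by
    ext i j
    rw [Matrix.mul_apply, Finset.sum_eq_single i.rev] <;>
      simp +contextual [Matrix.one_apply, eq_comm]

theorem reversal_mul_apply (M : Matrix (Fin n) (Fin n) F) (i j : Fin n) :
    ((reversal n F).val * M) i j = M i.rev j := by
  simp [reversal, Matrix.mul_apply, Matrix.one_apply]

theorem mul_reversal_apply (M : Matrix (Fin n) (Fin n) F) (i j : Fin n) :
    (M * (reversal n F).val) i j = M i j.rev := by
  simp [reversal, Matrix.mul_apply, Matrix.one_apply, Fin.rev_eq_iff]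

theorem reversal_inv : (reversal n F)⁻¹ = reversal n F := rfl

theorem reversal_mul_self : reversal n F * reversal n F = 1 := by
  rw [mul_eq_one_iff_eq_inv, reversal_inv]

theorem inverseTranspose_reversal : inverseTranspose n F (reversal n F) = reversal n F := by
  refine Units.ext ?_
  ext i j
  change (reversal n F).val j i = (reversal n F).val i j
  have : j = i.rev ↔ i = j.rev := ⟨by rintro rfl; simp, by rintro rfl; simp⟩
  simp [reversal, Matrix.one_apply, this, eq_comm]

theorem inverseTranspose_apply_apply (A : Matrix.GeneralLinearGroup (Fin n) F) :
    inverseTranspose n F (inverseTranspose n F A) = A :=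
  (inverseTranspose n F).left_inv A

theorem pairBlock_rev (hn : Even n) (i : Fin n) :
    pairBlock n i.rev + pairBlock n i + 1 = n / 2 := by
  obtain ⟨m, rfl⟩ := hn
  have := i.2
  simp only [pairBlock, Fin.val_rev]
  omega

/-- Transposition makes `p⁻¹` lower block triangular and reversing the basis makes it upper again.
Thus `τ` followed by conjugation by the reversal preserves the stabilizer, which reduces the
`τ`-coset of the normalizer to `GL_n`. -/
theorem reversal_conj_mem (hn : Even n) {p : Matrix.GeneralLinearGroup (Fin n) F}
    (hp : p ∈ flagStabilizer n F) :
    reversal n F * inverseTranspose n F p * reversal n F ∈ flagStabilizer n F := by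
  rw [mem_flagStabilizer hn]
  have h := (mem_flagStabilizer hn).1 (inv_mem hp)
  intro k l hkl
  rw [Units.val_mul, Units.val_mul, mul_reversal_apply, reversal_mul_apply]
  refine h (i := l.rev) (j := k.rev) ?_
  have := pairBlock_rev hn k
  have := pairBlock_rev hn l
  omega

/-- The generator of the complement in `GL_n(F) ⋊ ⟨τ⟩`. -/
def tauGen (n : ℕ) (F : Type*) [Field F] : Subgroup.zpowers (inverseTranspose n F) :=
  ⟨inverseTranspose n F, Subgroup.mem_zpowers _⟩

theorem eq_one_or_eq_tauGen (t : Subgroup.zpowers (inverseTranspose n F)) :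
    t = 1 ∨ t = tauGen n F := by
  obtain ⟨t, k, rfl⟩ := t
  have h2 : inverseTranspose n F * inverseTranspose n F = 1 :=
    MulEquiv.ext inverseTranspose_apply_apply
  have hz : inverseTranspose n F ^ (2 : ℤ) = 1 := by
    rw [zpow_ofNat, pow_two, h2]
  obtain ⟨c, rfl | rfl⟩ := Int.even_or_odd' k
  · left
    refine Subtype.ext ?_
    simp [zpow_mul, hz]
  · right
    refine Subtype.ext ?_
    simp [zpow_add, zpow_mul, hz, tauGen]

theorem tauGen_mul_self : tauGen n F * tauGen n F = 1 :=
  Subtype.ext (MulEquiv.ext inverseTranspose_apply_apply)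

theorem conj_mem_of_mem_flagNormalizer {A : Matrix.GeneralLinearGroup (Fin n) F}
    {t : Subgroup.zpowers (inverseTranspose n F)}
    (h : (⟨A, t⟩ : GLTau n F) ∈ flagNormalizer n F)
    {p : Matrix.GeneralLinearGroup (Fin n) F} (hp : p ∈ flagStabilizer n F) :
    A * t.1 p * A⁻¹ ∈ flagStabilizer n F := by
  have h1 := (Subgroup.mem_normalizer_iff.1 h (SemidirectProduct.inl p)).1
    (Subgroup.mem_map_of_mem _ hp)
  obtain ⟨p', hp', he⟩ := Subgroup.mem_map.1 h1
  have h2 := congrArg SemidirectProduct.left he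
  have h3 : p' = A * t.1 p * A⁻¹ := by
    simpa [SemidirectProduct.mul_left, SemidirectProduct.inv_left] using h2
  rwa [← h3]

theorem mem_flagStabilizer_of_inl_mem (hn : Even n) {A : Matrix.GeneralLinearGroup (Fin n) F}
    (h : (⟨A, 1⟩ : GLTau n F) ∈ flagNormalizer n F) : A ∈ flagStabilizer n F :=
  mem_flagStabilizer_of_conj hn fun _ hp => conj_mem_of_mem_flagNormalizer h hp

theorem inl_mem_flagNormalizer {A : Matrix.GeneralLinearGroup (Fin n) F}
    (h : A ∈ flagStabilizer n F) : (SemidirectProduct.inl A : GLTau n F) ∈ flagNormalizer n F :=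
  Subgroup.le_normalizer (Subgroup.mem_map_of_mem _ h)

theorem mul_reversal_mem_of_mem (hn : Even n) {A : Matrix.GeneralLinearGroup (Fin n) F}
    (h : (⟨A, tauGen n F⟩ : GLTau n F) ∈ flagNormalizer n F) :
    A * reversal n F ∈ flagStabilizer n F := by
  refine mem_flagStabilizer_of_conj hn fun p hp => ?_
  have h1 := conj_mem_of_mem_flagNormalizer h (reversal_conj_mem hn hp)
  have h2 : (tauGen n F).1 (reversal n F * inverseTranspose n F p * reversal n F)
      = reversal n F * p * reversal n F := by
    change inverseTranspose n F _ = _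
    rw [map_mul, map_mul, inverseTranspose_reversal, inverseTranspose_apply_apply]
  rw [h2] at h1
  rw [mul_inv_rev, reversal_inv]
  simpa only [mul_assoc] using h1

/-- Central matrices centralize `P`, and conjugation in the extended group preserves the centre. -/
theorem inl_mem_normalCore {z : Matrix.GeneralLinearGroup (Fin n) F}
    (hz : z ∈ Subgroup.center (Matrix.GeneralLinearGroup (Fin n) F)) :
    (SemidirectProduct.inl z : GLTau n F) ∈ (flagNormalizer n F).normalCore := by
  have hH : ∀ z ∈ Subgroup.center (Matrix.GeneralLinearGroup (Fin n) F),
      (SemidirectProduct.inl z : GLTau n F) ∈ flagNormalizer n F := by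
    intro z hz
    have hc : ∀ p, (SemidirectProduct.inl z : GLTau n F) * SemidirectProduct.inl p
        = SemidirectProduct.inl p * SemidirectProduct.inl z := by
      intro p
      rw [← map_mul, ← map_mul, Subgroup.mem_center_iff.1 hz p]
    refine Subgroup.mem_normalizer_iff.2 fun x => ⟨?_, ?_⟩
    · rintro ⟨p, hp, rfl⟩
      rw [hc, mul_inv_cancel_right]
      exact ⟨p, hp, rfl⟩
    · rintro ⟨p, hp, he⟩
      have : x = SemidirectProduct.inl p := by
        rw [eq_mul_inv_iff_mul_eq, ← hc] at he
        exact (mul_left_cancel he).symm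
      rw [this]
      exact ⟨p, hp, rfl⟩
  intro a
  obtain ⟨A, t⟩ := a
  have htz : t.1 z ∈ Subgroup.center (Matrix.GeneralLinearGroup (Fin n) F) := by
    rw [Subgroup.mem_center_iff] at hz ⊢
    intro g
    rw [← t.1.apply_symm_apply g, ← map_mul, ← map_mul, hz]
  have e : (⟨A, t⟩ : GLTau n F) * SemidirectProduct.inl z * (⟨A, t⟩ : GLTau n F)⁻¹
      = SemidirectProduct.inl (t.1 z) := by
    refine SemidirectProduct.ext ?_ ?_
    · simp [SemidirectProduct.mul_left, SemidirectProduct.inv_left]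
      rw [Subgroup.mem_center_iff.1 htz A, mul_inv_cancel_right]
    · simp
  rw [e]
  exact hH _ htz

end Reversal

/-! ### Counting regular orbits from a distinguished entry -/

section RegularOrbits

theorem le_numRegularOrbits_of_unique {G Ω : Type*} [Group G] [MulAction G Ω] [Finite Ω] {m : ℕ}
    (x : Fin m → Ω) (hx : MulAction.stabilizer G x = ⊥) (R : Ω → Ω → Prop)
    (hR : ∀ (g : G) (a b : Ω), R a b → R (g • a) (g • b)) (s : Fin m)
    (hs : ∀ j, j ≠ s → R (x s) (x j)) (hns : ∀ i, i ≠ s → ∃ j, j ≠ i ∧ ¬ R (x i) (x j)) :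
    m ≤ numRegularOrbits G Ω m := by
  let y : Fin m → Fin m → Ω := fun k => x ∘ Equiv.swap s k
  have hreg : ∀ k, MulAction.stabilizer G (y k) = ⊥ := by
    intro k
    rw [← hx]
    ext g
    simp only [MulAction.mem_stabilizer_iff, funext_iff, Pi.smul_apply, y, Function.comp_apply]
    exact (Equiv.swap s k).forall_congr_right (q := fun i => g • x i = x i)
  have hinj : Function.Injective fun k => MulAction.orbit G (y k) := by
    intro k l hkl
    obtain ⟨g, hg⟩ : y l ∈ MulAction.orbit G (y k) := by
      rw [show MulAction.orbit G (y k) = MulAction.orbit G (y l) from hkl]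
      exact MulAction.mem_orbit_self _
    have hg' : ∀ i, g • x (Equiv.swap s k i) = x (Equiv.swap s l i) := fun i => congrFun hg i
    by_contra hne
    -- At position `k`, `g` sends the distinguished entry `x s` to `x (swap s l k)`, which would
    -- then also be related to all the other entries.
    have h1 : Equiv.swap s l k ≠ s := by
      intro h
      rw [Equiv.swap_apply_eq_iff, Equiv.swap_apply_left] at h
      exact hne h
    obtain ⟨j, hj, hRj⟩ := hns _ h1
    refine hRj ?_
    obtain ⟨i, rfl⟩ := (Equiv.swap s l).surjective j
    have hik : i ≠ k := fun h => hj (by rw [h])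
    rw [← hg', ← hg', Equiv.swap_apply_right]
    refine hR _ _ _ (hs _ fun h => hik ?_)
    rwa [Equiv.swap_apply_eq_iff, Equiv.swap_apply_left] at h
  calc m = (Set.range fun k => MulAction.orbit G (y k)).ncard := by
        rw [← Set.image_univ, Set.ncard_image_of_injective _ hinj, Set.ncard_univ, Nat.card_fin]
    _ ≤ _ := by
        refine Set.ncard_le_ncard ?_ (Set.toFinite _)
        rintro _ ⟨k, rfl⟩
        exact ⟨y k, hreg k, rfl⟩

end RegularOrbits

/-! ### Unipotent matrices `1 + N` with `N` in the last two rows -/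

section Unipotent

variable {n : ℕ} {F : Type*} [Field F]

/-- Matrices whose nonzero entries lie in the last two rows, outside the last two columns. -/
structure IsLastRows (N : Matrix (Fin n) (Fin n) F) : Prop where
  row : ∀ k l : Fin n, (k : ℕ) + 2 < n → N k l = 0
  col : ∀ k l : Fin n, n ≤ (l : ℕ) + 2 → N k l = 0

theorem IsLastRows.mul_eq_zero {N N' : Matrix (Fin n) (Fin n) F} (hN : IsLastRows N)
    (hN' : IsLastRows N') : N * N' = 0 := by
  ext k l
  rw [Matrix.mul_apply]
  refine Finset.sum_eq_zero fun i _ => ?_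
  by_cases hi : (i : ℕ) + 2 < n
  · rw [hN'.row i l hi, mul_zero]
  · rw [hN.col k i (not_lt.1 hi), zero_mul]

/-- The invertible matrix `1 + N`. -/
def IsLastRows.unipotent {N : Matrix (Fin n) (Fin n) F} (hN : IsLastRows N) :
    Matrix.GeneralLinearGroup (Fin n) F where
  val := 1 + N
  inv := 1 - N
  val_inv := by
    rw [add_mul, mul_sub, mul_sub, hN.mul_eq_zero hN]; simp
  inv_val := by
    rw [sub_mul, mul_add, mul_add, hN.mul_eq_zero hN]; simp

theorem IsLastRows.zero : IsLastRows (0 : Matrix (Fin n) (Fin n) F) :=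
  ⟨fun _ _ _ => rfl, fun _ _ _ => rfl⟩

theorem IsLastRows.single {i j : Fin n} (hi : n ≤ (i : ℕ) + 2) (hj : (j : ℕ) + 2 < n) :
    IsLastRows (Matrix.single i j (1 : F)) := by
  refine ⟨fun k l hk => ?_, fun k l hl => ?_⟩
  · rw [Matrix.single_apply_of_row_ne]
    rintro rfl; omega
  · rw [Matrix.single_apply_of_col_ne]
    rintro rfl; omega

/-- The matrix `N` such that the last two rows of `1 + N` are `(I, I, …, I)`. -/
def sumRows (n : ℕ) (F : Type*) [Field F] : Matrix (Fin n) (Fin n) F :=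
  Matrix.of fun k l => if n ≤ (k : ℕ) + 2 ∧ (l : ℕ) + 2 < n ∧ (k : ℕ) % 2 = (l : ℕ) % 2
    then 1 else 0

theorem IsLastRows.sumRows : IsLastRows (sumRows n F) := by
  refine ⟨fun k l hk => if_neg ?_, fun k l hl => if_neg ?_⟩ <;> omega

theorem IsLastRows.unipotent_mul_inv {N N' : Matrix (Fin n) (Fin n) F} (hN : IsLastRows N)
    (hN' : IsLastRows N') : (hN.unipotent * hN'.unipotent⁻¹).val = 1 + N - N' := by
  change (1 + N) * (1 - N') = _
  rw [add_mul, mul_sub, mul_sub, hN.mul_eq_zero hN', one_mul, mul_one, one_mul]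
  abel

/-- Reversal moves the support of `N` to the first two rows and the last `n - 2` columns. This is
what makes the flag of `1 + N` opposite to that of the reversal. -/
theorem IsLastRows.reversal_conj_inv_mem (hn : Even n) {N : Matrix (Fin n) (Fin n) F}
    (hN : IsLastRows N) :
    reversal n F * hN.unipotent⁻¹ * reversal n F ∈ flagStabilizer n F := by
  rw [mem_flagStabilizer hn]
  intro k l hkl
  rw [Units.val_mul, Units.val_mul, mul_reversal_apply, reversal_mul_apply]
  change (1 - N) k.rev l.rev = 0
  have hne : k.rev ≠ l.rev := by
    intro h
    rw [Fin.rev_injective h] at hkl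
    exact lt_irrefl _ hkl
  rw [Matrix.sub_apply, Matrix.one_apply_ne hne, zero_sub, neg_eq_zero]
  by_cases hk : (k.rev : ℕ) + 2 < n
  · exact hN.row _ _ hk
  · refine hN.col _ _ ?_
    simp only [pairBlock, Fin.val_rev] at *
    have := k.2
    have := l.2
    omega

/-- A block diagonal matrix which `1 + N` conjugates into the flag stabilizer commutes with `N`. -/
theorem IsLastRows.commute (hn : Even n) {N : Matrix (Fin n) (Fin n) F} (hN : IsLastRows N)
    {A : Matrix.GeneralLinearGroup (Fin n) F}
    (hA : ∀ k l, pairBlock n k ≠ pairBlock n l → A.val k l = 0)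
    (h : hN.unipotent * A * hN.unipotent⁻¹ ∈ flagStabilizer n F) : N * A.val = A.val * N := by
  obtain ⟨m, rfl⟩ := hn
  have hlast : ∀ k l : Fin (m + m), (k : ℕ) + 2 < m + m → m + m ≤ (l : ℕ) + 2 →
      A.val k l = 0 ∧ A.val l k = 0 := by
    intro k l hk hl
    have := l.2
    constructor <;> refine hA _ _ ?_ <;> simp only [pairBlock] <;> omega
  have hNA : IsLastRows (N * A.val) := by
    refine ⟨fun k l hk => ?_, fun k l hl => ?_⟩ <;> rw [Matrix.mul_apply] <;>
      refine Finset.sum_eq_zero fun i _ => ?_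
    · rw [hN.row _ _ hk, zero_mul]
    · by_cases hi : (i : ℕ) + 2 < m + m
      · rw [(hlast i l hi hl).1, mul_zero]
      · rw [hN.col _ _ (not_lt.1 hi), zero_mul]
  have hAN : IsLastRows (A.val * N) := by
    refine ⟨fun k l hk => ?_, fun k l hl => ?_⟩ <;> rw [Matrix.mul_apply] <;>
      refine Finset.sum_eq_zero fun i _ => ?_
    · by_cases hi : (i : ℕ) + 2 < m + m
      · rw [hN.row _ _ hi, mul_zero]
      · rw [(hlast k i hk (not_lt.1 hi)).1, zero_mul]
    · rw [hN.col _ _ hl, mul_zero]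
  -- The term `N A N` vanishes. On the support of `N`, which lies below the diagonal blocks, `A` is
  -- zero, so membership in `P` reads `N A = A N` there.
  have hval : (hN.unipotent * A * hN.unipotent⁻¹).val = A.val + N * A.val - A.val * N := by
    change (1 + N) * A.val * (1 - N) = _
    rw [add_mul, mul_sub, add_mul, add_mul, hNA.mul_eq_zero hN]
    simp
  ext k l
  by_cases hk : (k : ℕ) + 2 < m + m
  · rw [hNA.row _ _ hk, hAN.row _ _ hk]
  by_cases hl : (l : ℕ) + 2 < m + m
  · have h1 := (mem_flagStabilizer ⟨m, rfl⟩).1 h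
      (show pairBlock (m + m) l < pairBlock (m + m) k by simp only [pairBlock]; omega)
    rw [hval, Matrix.sub_apply, Matrix.add_apply, (hlast l k hl (not_lt.1 hk)).2, zero_add,
      sub_eq_zero] at h1
    exact h1
  · rw [hNA.col _ _ (not_lt.1 hl), hAN.col _ _ (not_lt.1 hl)]

end Unipotent

/-! ### Fixed flags and opposite flags -/

section Cosets

variable {n : ℕ} {F : Type*} [Field F]

/-- The coset of the flag normalizer attached to the flag spanned by the last rows of `h`. -/
def rowFlag (h : Matrix.GeneralLinearGroup (Fin n) F) : GLTau n F ⧸ flagNormalizer n F :=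
  QuotientGroup.mk (SemidirectProduct.inl h⁻¹)

theorem conj_mem_of_smul_rowFlag (hn : Even n) {A h : Matrix.GeneralLinearGroup (Fin n) F}
    (hA : (⟨A, 1⟩ : GLTau n F) • rowFlag h = rowFlag h) : h * A * h⁻¹ ∈ flagStabilizer n F := by
  have h1 := QuotientGroup.eq.1 hA.symm
  refine mem_flagStabilizer_of_inl_mem hn ?_
  convert h1 using 1
  refine SemidirectProduct.ext ?_ ?_
  · simp [SemidirectProduct.mul_left, SemidirectProduct.inv_left, mul_assoc]
  · simp

theorem apply_eq_zero_of_smul_rowFlag (hn : Even n) {M h : Matrix.GeneralLinearGroup (Fin n) F}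
    (hM : (⟨M, tauGen n F⟩ : GLTau n F) • rowFlag h = rowFlag h) {k l : Fin n}
    (hkl : n / 2 ≤ pairBlock n k + pairBlock n l) :
    (h.val * M.val * h.val.transpose) k l = 0 := by
  have h1 := QuotientGroup.eq.1 hM.symm
  have h2 : (⟨h * M * inverseTranspose n F h⁻¹, tauGen n F⟩ : GLTau n F)
      ∈ flagNormalizer n F := by
    convert h1 using 1
    refine SemidirectProduct.ext ?_ ?_
    · simp [SemidirectProduct.mul_left, SemidirectProduct.inv_left, mul_assoc, tauGen]
    · simp
  have h3 := (mem_flagStabilizer hn).1 (mul_reversal_mem_of_mem hn h2) (i := k) (j := l.rev) (by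
    have := pairBlock_rev hn l
    omega)
  rw [Units.val_mul, mul_reversal_apply, Fin.rev_rev] at h3
  exact h3

/-- Two cosets are opposite if they are in the relative position of the standard flag and its
reversal. -/
def IsOpposite (x y : GLTau n F ⧸ flagNormalizer n F) : Prop :=
  ∃ a : GLTau n F, x = QuotientGroup.mk a ∧
    y = QuotientGroup.mk (a * SemidirectProduct.inl (reversal n F))

theorem IsOpposite.smul (g : GLTau n F) {x y : GLTau n F ⧸ flagNormalizer n F}
    (h : IsOpposite x y) : IsOpposite (g • x) (g • y) := by
  obtain ⟨a, rfl, rfl⟩ := h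
  refine ⟨g * a, rfl, ?_⟩
  rw [mul_assoc]
  rfl

theorem isOpposite_reversal {h : Matrix.GeneralLinearGroup (Fin n) F}
    (hh : reversal n F * h⁻¹ * reversal n F ∈ flagStabilizer n F) :
    IsOpposite (rowFlag (reversal n F)) (rowFlag h) := by
  -- With this choice the second coset is that of `h⁻¹` exactly; only the first uses the hypothesis.
  refine ⟨SemidirectProduct.inl (h⁻¹ * reversal n F), ?_, ?_⟩
  · refine QuotientGroup.eq.2 ?_
    rw [← map_inv, ← map_mul, inv_inv, ← mul_assoc]
    exact inl_mem_flagNormalizer hh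
  · rw [← map_mul, mul_assoc, reversal_mul_self, mul_one]
    rfl

/-- Even when the witness involves `τ`, the double coset `P w P` is unchanged, because `τ` fixes `w`
and `w τ(P) w = P`. -/
theorem IsOpposite.exists_mul {h h' : Matrix.GeneralLinearGroup (Fin n) F} (hn : Even n)
    (ho : IsOpposite (rowFlag h) (rowFlag h')) :
    ∃ p ∈ flagStabilizer n F, ∃ p' ∈ flagStabilizer n F, h * h'⁻¹ = p * reversal n F * p' := by
  obtain ⟨a, ha, ha'⟩ := ho
  have h1 := QuotientGroup.eq.1 ha
  have h2 := QuotientGroup.eq.1 ha'.symm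
  obtain ⟨A, t⟩ := a
  obtain rfl | rfl := eq_one_or_eq_tauGen t
  · have e1 : h * A ∈ flagStabilizer n F := by
      refine mem_flagStabilizer_of_inl_mem hn ?_
      convert h1 using 1
      refine SemidirectProduct.ext ?_ ?_
      · simp [SemidirectProduct.mul_left]
      · simp
    have e2 : (A * reversal n F)⁻¹ * h'⁻¹ ∈ flagStabilizer n F := by
      refine mem_flagStabilizer_of_inl_mem hn ?_
      convert h2 using 1
      refine SemidirectProduct.ext ?_ ?_
      · simp [SemidirectProduct.mul_left, SemidirectProduct.inv_left]
      · simp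
    refine ⟨_, e1, _, e2, ?_⟩
    group
  · have e1 : h * A * reversal n F ∈ flagStabilizer n F := by
      refine mul_reversal_mem_of_mem hn ?_
      convert h1 using 1
      refine SemidirectProduct.ext ?_ ?_
      · simp [SemidirectProduct.mul_left]
      · simp
    have e2 : (inverseTranspose n F (A * reversal n F))⁻¹ * inverseTranspose n F h'⁻¹
        * reversal n F ∈ flagStabilizer n F := by
      refine mul_reversal_mem_of_mem hn ?_
      have ht : (tauGen n F)⁻¹ = tauGen n F := (eq_inv_of_mul_eq_one_left tauGen_mul_self).symm
      convert h2 using 1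
      refine SemidirectProduct.ext ?_ ?_
      · simp [SemidirectProduct.mul_left, SemidirectProduct.inv_left, ht]
        simp [tauGen, inverseTranspose_reversal]
      · simp [ht]
    refine ⟨_, e1, _, reversal_conj_mem hn e2, ?_⟩
    simp only [map_mul, map_inv, inverseTranspose_reversal, inverseTranspose_apply_apply]
    simp only [mul_inv_rev, reversal_inv, mul_assoc]
    rw [reversal_mul_self, mul_one, ← mul_assoc (reversal n F) (reversal n F), reversal_mul_self,
      one_mul]
    simp only [← mul_assoc]
    rw [mul_assoc _ (reversal n F) (reversal n F), reversal_mul_self, mul_one,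
      mul_assoc _ A, mul_inv_cancel, mul_one]

/-- In `p w p'` the bottom left block is a product of invertible blocks, so none of its rows
vanishes. The proof shows that a zero row there would give a zero row of the invertible matrix `p
w`. -/
theorem IsOpposite.exists_ne_zero {h h' : Matrix.GeneralLinearGroup (Fin n) F} (hn : Even n)
    (ho : IsOpposite (rowFlag h) (rowFlag h')) {k : Fin n} (hk : n ≤ (k : ℕ) + 2) :
    ∃ l : Fin n, (l : ℕ) < 2 ∧ (h * h'⁻¹).val k l ≠ 0 := by
  obtain ⟨p, hp, p', hp', e⟩ := ho.exists_mul hn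
  by_contra! hcon
  have hp1 := (mem_flagStabilizer hn).1 hp
  have hp2 := (mem_flagStabilizer hn).1 (inv_mem hp')
  have hval : p.val * (reversal n F).val = (h * h'⁻¹).val * (p'⁻¹).val := by
    rw [← Units.val_mul, ← Units.val_mul, e, mul_inv_cancel_right]
  have hz : ∀ l : Fin n, (p.val * (reversal n F).val) k l = 0 := by
    intro l
    by_cases hl : (l : ℕ) < 2
    · rw [hval, Matrix.mul_apply]
      refine Finset.sum_eq_zero fun i _ => ?_
      by_cases hi : (i : ℕ) < 2
      · rw [hcon i hi, zero_mul]
      · rw [hp2 (show pairBlock n l < pairBlock n i by simp only [pairBlock]; omega), mul_zero]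
    · rw [mul_reversal_apply]
      refine hp1 ?_
      obtain ⟨m, rfl⟩ := hn
      simp only [pairBlock, Fin.val_rev]
      have := k.2
      have := l.2
      omega
  have h1 : ((p * reversal n F).val * ((p * reversal n F)⁻¹).val) k k = 1 := by
    rw [Units.mul_inv, Matrix.one_apply_eq]
  rw [Matrix.mul_apply, Units.val_mul] at h1
  simp [hz] at h1

end Cosets

/-! ### The five flags: trivial stabilizer modulo the core, and their opposition pattern -/

section Base

variable {n : ℕ} {F : Type*} [Field F]

/-- Commuting with `E_{n-2,j}` makes row `j` of `A` equal to `c` times a basis vector, for `j = 0,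
1`; commuting with `sumRows` identifies every diagonal block with the last one. -/
theorem mem_center_of_commute (hn : Even n) (hn4 : 4 ≤ n)
    {A : Matrix.GeneralLinearGroup (Fin n) F}
    (hA : ∀ k l, pairBlock n k ≠ pairBlock n l → A.val k l = 0)
    (h0 : Matrix.single ⟨n - 2, by omega⟩ ⟨0, by omega⟩ 1 * A.val
      = A.val * Matrix.single ⟨n - 2, by omega⟩ ⟨0, by omega⟩ 1)
    (h1 : Matrix.single ⟨n - 2, by omega⟩ ⟨1, by omega⟩ 1 * A.val
      = A.val * Matrix.single ⟨n - 2, by omega⟩ ⟨1, by omega⟩ 1)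
    (hs : sumRows n F * A.val = A.val * sumRows n F) :
    A ∈ Subgroup.center (Matrix.GeneralLinearGroup (Fin n) F) := by
  set c := A.val ⟨n - 2, by omega⟩ ⟨n - 2, by omega⟩ with hc
  obtain ⟨m, rfl⟩ := hn
  have a00 : A.val ⟨0, by omega⟩ ⟨0, by omega⟩ = c := by
    have := congrFun (congrFun h0 ⟨m + m - 2, by omega⟩) ⟨0, by omega⟩
    simpa using this
  have a01 : A.val ⟨0, by omega⟩ ⟨1, by omega⟩ = 0 := by
    have := congrFun (congrFun h0 ⟨m + m - 2, by omega⟩) ⟨1, by omega⟩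
    simpa using this
  have a10 : A.val ⟨1, by omega⟩ ⟨0, by omega⟩ = 0 := by
    have := congrFun (congrFun h1 ⟨m + m - 2, by omega⟩) ⟨0, by omega⟩
    simpa using this
  have a11 : A.val ⟨1, by omega⟩ ⟨1, by omega⟩ = c := by
    have := congrFun (congrFun h1 ⟨m + m - 2, by omega⟩) ⟨1, by omega⟩
    simpa using this
  have first : ∀ k l : Fin (m + m), (k : ℕ) < 2 → (l : ℕ) < 2 →
      A.val k l = if k = l then c else 0 := by
    rintro ⟨k, hk⟩ ⟨l, hl⟩ hk2 hl2
    simp only at hk2 hl2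
    interval_cases k <;> interval_cases l <;> simp [a00, a01, a10, a11]
  have move : ∀ a : ℕ, ∀ ha : a < 2, ∀ l : Fin (m + m), (hl : (l : ℕ) + 2 < m + m) →
      A.val ⟨2 * ((l : ℕ) / 2) + a, by omega⟩ l
        = A.val ⟨m + m - 2 + a, by omega⟩ ⟨m + m - 2 + (l : ℕ) % 2, by omega⟩ := by
    intro a ha l hl
    have h := congrFun (congrFun hs ⟨m + m - 2 + a, by omega⟩) l
    rw [Matrix.mul_apply, Matrix.mul_apply,
      Finset.sum_eq_single ⟨2 * ((l : ℕ) / 2) + a, by omega⟩,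
      Finset.sum_eq_single ⟨m + m - 2 + (l : ℕ) % 2, by omega⟩] at h
    · have c1 : sumRows (m + m) F ⟨m + m - 2 + a, by omega⟩ ⟨2 * ((l : ℕ) / 2) + a, by omega⟩
          = 1 := if_pos (by simp only; omega)
      have c2 : sumRows (m + m) F ⟨m + m - 2 + (l : ℕ) % 2, by omega⟩ l = 1 :=
        if_pos (by simp only; omega)
      rwa [c1, c2, one_mul, mul_one] at h
    · intro i _ hi
      by_cases hb : pairBlock (m + m) ⟨m + m - 2 + a, by omega⟩ = pairBlock (m + m) i
      · rw [show sumRows (m + m) F i l = 0 from if_neg ?_, mul_zero]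
        rintro ⟨h1, h2, h3⟩
        refine hi (Fin.ext ?_)
        have := i.2
        simp only
        omega
      · rw [hA _ _ hb, zero_mul]
    · simp
    · intro i _ hi
      by_cases hb : pairBlock (m + m) i = pairBlock (m + m) l
      · rw [show sumRows (m + m) F ⟨m + m - 2 + a, by omega⟩ i = 0 from if_neg ?_, zero_mul]
        rintro ⟨h1, h2, h3⟩
        refine hi (Fin.ext ?_)
        simp only [pairBlock] at *
        omega
      · rw [hA _ _ hb, mul_zero]
    · simp
  have last : ∀ a b : ℕ, ∀ ha : a < 2, ∀ hb : b < 2,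
      A.val ⟨m + m - 2 + a, by omega⟩ ⟨m + m - 2 + b, by omega⟩ = if a = b then c else 0 := by
    intro a b ha hb
    have h := move a ha ⟨b, by omega⟩ (by simp only; omega)
    rw [first _ _ (by simp only; omega) hb] at h
    simp only [Nat.mod_eq_of_lt hb, Nat.div_eq_of_lt hb, Fin.mk.injEq] at h
    rw [← h]
    simp
  have hscalar : A.val = c • (1 : Matrix (Fin (m + m)) (Fin (m + m)) F) := by
    ext k l
    rw [Matrix.smul_apply, Matrix.one_apply, smul_eq_mul, mul_ite, mul_one, mul_zero]
    by_cases hb : pairBlock (m + m) k = pairBlock (m + m) l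
    · have hk := k.2
      simp only [pairBlock] at hb
      by_cases hl : (l : ℕ) + 2 < m + m
      · have h := move ((k : ℕ) % 2) (by omega) l hl
        rw [last _ _ (by omega) (by omega)] at h
        have e : (⟨2 * ((l : ℕ) / 2) + (k : ℕ) % 2, by omega⟩ : Fin (m + m)) = k :=
          Fin.ext (by simp only; omega)
        rw [e] at h
        rw [h]
        refine if_congr ?_ rfl rfl
        rw [Fin.ext_iff]
        omega
      · have h := last ((k : ℕ) - (m + m - 2)) ((l : ℕ) - (m + m - 2)) (by omega) (by omega)
        have e1 : (⟨m + m - 2 + ((k : ℕ) - (m + m - 2)), by omega⟩ : Fin (m + m)) = k :=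
          Fin.ext (by simp only; omega)
        have e2 : (⟨m + m - 2 + ((l : ℕ) - (m + m - 2)), by omega⟩ : Fin (m + m)) = l :=
          Fin.ext (by simp only; omega)
        rw [e1, e2] at h
        rw [h]
        refine if_congr ?_ rfl rfl
        rw [Fin.ext_iff]
        omega
    · rw [hA _ _ hb, if_neg]
      rintro rfl
      exact hb rfl
  rw [Subgroup.mem_center_iff]
  intro g
  refine Units.ext ?_
  rw [Units.val_mul, Units.val_mul, hscalar]
  simp

theorem isLastRows_single_zero (F : Type*) [Field F] (hn4 : 4 ≤ n) :
    IsLastRows (Matrix.single (⟨n - 2, by omega⟩ : Fin n) ⟨0, by omega⟩ (1 : F)) :=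
  IsLastRows.single (by simp only; omega) (by simp only; omega)

theorem isLastRows_single_one (F : Type*) [Field F] (hn4 : 4 ≤ n) :
    IsLastRows (Matrix.single (⟨n - 2, by omega⟩ : Fin n) ⟨1, by omega⟩ (1 : F)) :=
  IsLastRows.single (by simp only; omega) (by simp only; omega)

/-- Matrices whose last rows span five flags in general enough position. -/
def baseMatrix (F : Type*) [Field F] (hn4 : 4 ≤ n) :
    Fin 5 → Matrix.GeneralLinearGroup (Fin n) F :=
  ![(IsLastRows.zero (n := n) (F := F)).unipotent,
    reversal n F,
    (IsLastRows.sumRows (n := n) (F := F)).unipotent,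
    (isLastRows_single_zero F hn4).unipotent,
    (isLastRows_single_one F hn4).unipotent]

theorem mem_center_of_fixes (hn : Even n) (hn4 : 4 ≤ n)
    {A : Matrix.GeneralLinearGroup (Fin n) F}
    (h : ∀ i, (⟨A, 1⟩ : GLTau n F) • rowFlag (baseMatrix F hn4 i)
      = rowFlag (baseMatrix F hn4 i)) :
    A ∈ Subgroup.center (Matrix.GeneralLinearGroup (Fin n) F) := by
  have hfix := fun i => conj_mem_of_smul_rowFlag hn (h i)
  have hd : ∀ k l, pairBlock n k ≠ pairBlock n l → A.val k l = 0 := by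
    intro k l hkl
    rcases lt_or_gt_of_ne hkl with hlt | hlt
    · have h1 := (mem_flagStabilizer hn).1 (hfix 1) (i := k.rev) (j := l.rev) (by
        have := pairBlock_rev hn k
        have := pairBlock_rev hn l
        omega)
      change (reversal n F * A * (reversal n F)⁻¹).val _ _ = 0 at h1
      rw [reversal_inv, Units.val_mul, Units.val_mul, mul_reversal_apply, reversal_mul_apply,
        Fin.rev_rev, Fin.rev_rev] at h1
      exact h1
    · have h0 := (mem_flagStabilizer hn).1 (hfix 0) hlt
      change ((1 + 0) * A.val * (1 - 0) : Matrix (Fin n) (Fin n) F) k l = 0 at h0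
      simpa using h0
  exact mem_center_of_commute hn hn4 hd ((isLastRows_single_zero F hn4).commute hn hd (hfix 3))
    ((isLastRows_single_one F hn4).commute hn hd (hfix 4))
    (IsLastRows.sumRows.commute hn hd (hfix 2))

theorem not_tauGen_fixes (hn : Even n) (hn4 : 4 ≤ n)
    {M : Matrix.GeneralLinearGroup (Fin n) F}
    (h : ∀ i, (⟨M, tauGen n F⟩ : GLTau n F) • rowFlag (baseMatrix F hn4 i)
      = rowFlag (baseMatrix F hn4 i)) : False := by
  obtain ⟨m, rfl⟩ := hn
  have hanti : ∀ k : Fin (m + m), 2 ≤ (k : ℕ) → M.val k ⟨m + m - 1, by omega⟩ = 0 := by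
    intro k hk
    have h0 := apply_eq_zero_of_smul_rowFlag ⟨m, rfl⟩ (h 0) (k := k) (l := ⟨m + m - 1, by omega⟩)
      (by simp only [pairBlock]; omega)
    change ((1 + 0) * M.val * (1 + 0 : Matrix (Fin (m + m)) (Fin (m + m)) F).transpose) _ _ = 0
      at h0
    simpa using h0
  -- For `h = 1 + E_{n-2,j}`, the entry of `h M hᵀ` at `(n-2, n-1)` is `M (n-2) (n-1) + M j (n-1)`,
  -- whose first term is already zero.
  have hfirst : ∀ (j : Fin (m + m)), (j : ℕ) < 2 →
      ((1 + Matrix.single (⟨m + m - 2, by omega⟩ : Fin (m + m)) j (1 : F)) * M.val *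
        (1 + Matrix.single (⟨m + m - 2, by omega⟩ : Fin (m + m)) j (1 : F)).transpose)
          ⟨m + m - 2, by omega⟩ ⟨m + m - 1, by omega⟩ = 0 → M.val j ⟨m + m - 1, by omega⟩ = 0 := by
    intro j hj hz
    have hne : (⟨m + m - 1, by omega⟩ : Fin (m + m)) ≠ ⟨m + m - 2, by omega⟩ := by
      intro e
      have := congrArg Fin.val e
      simp only at this
      omega
    rw [Matrix.transpose_add, Matrix.transpose_one, Matrix.transpose_single, mul_add, mul_one,
      Matrix.add_apply, Matrix.mul_single_apply_of_ne _ _ _ _ _ hne, add_zero, add_mul, one_mul,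
      Matrix.add_apply, hanti _ (by simp only; omega), zero_add, Matrix.single_mul_apply_same,
      one_mul] at hz
    exact hz
  have hb : (m + m) / 2 ≤ pairBlock (m + m) ⟨m + m - 2, by omega⟩
      + pairBlock (m + m) ⟨m + m - 1, by omega⟩ := by
    simp only [pairBlock]; omega
  have m0 := hfirst ⟨0, by omega⟩ (by simp)
    (apply_eq_zero_of_smul_rowFlag ⟨m, rfl⟩ (h 3) hb)
  have m1 := hfirst ⟨1, by omega⟩ (by simp)
    (apply_eq_zero_of_smul_rowFlag ⟨m, rfl⟩ (h 4) hb)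
  have hcol : ∀ k, M.val k ⟨m + m - 1, by omega⟩ = 0 := by
    intro k
    rcases k with ⟨_ | _ | k, hk⟩
    · exact m0
    · exact m1
    · exact hanti _ (by simp)
  have h1 : ((M⁻¹).val * M.val) ⟨m + m - 1, by omega⟩ ⟨m + m - 1, by omega⟩ = 1 := by
    rw [Units.inv_mul, Matrix.one_apply_eq]
  rw [Matrix.mul_apply] at h1
  simp [hcol] at h1

theorem isOpposite_baseMatrix_one (hn : Even n) (hn4 : 4 ≤ n) (j : Fin 5) (hj : j ≠ 1) :
    IsOpposite (rowFlag (baseMatrix F hn4 1)) (rowFlag (baseMatrix F hn4 j)) := by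
  refine isOpposite_reversal ?_
  fin_cases j
  · exact IsLastRows.zero.reversal_conj_inv_mem hn
  · exact absurd rfl hj
  · exact IsLastRows.sumRows.reversal_conj_inv_mem hn
  · exact (isLastRows_single_zero F hn4).reversal_conj_inv_mem hn
  · exact (isLastRows_single_one F hn4).reversal_conj_inv_mem hn

theorem not_isOpposite_unipotent (hn : Even n) (hn4 : 4 ≤ n) {N N' : Matrix (Fin n) (Fin n) F}
    (hN : IsLastRows N) (hN' : IsLastRows N') (k : Fin n) (hk : n ≤ (k : ℕ) + 2)
    (h : ∀ l : Fin n, (l : ℕ) < 2 → N k l = N' k l) :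
    ¬ IsOpposite (rowFlag hN.unipotent) (rowFlag hN'.unipotent) := by
  intro ho
  obtain ⟨l, hl, hne⟩ := ho.exists_ne_zero hn hk
  have hkl : k ≠ l := by rintro rfl; omega
  rw [hN.unipotent_mul_inv hN', Matrix.sub_apply, Matrix.add_apply, Matrix.one_apply_ne hkl,
    zero_add, h l hl, sub_self] at hne
  exact hne rfl

theorem exists_not_isOpposite_baseMatrix (hn : Even n) (hn4 : 4 ≤ n) (i : Fin 5) (hi : i ≠ 1) :
    ∃ j, j ≠ i ∧ ¬ IsOpposite (rowFlag (baseMatrix F hn4 i)) (rowFlag (baseMatrix F hn4 j)) := by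
  have hne : (⟨n - 2, by omega⟩ : Fin n) ≠ ⟨n - 1, by omega⟩ := by
    intro e
    have := congrArg Fin.val e
    simp only at this
    omega
  fin_cases i
  · refine ⟨3, by decide, not_isOpposite_unipotent hn hn4 IsLastRows.zero
      (isLastRows_single_zero F hn4) ⟨n - 1, by omega⟩
      (by simp only; omega) fun l _ => ?_⟩
    rw [Matrix.single_apply_of_row_ne hne]; rfl
  · exact absurd rfl hi
  -- Row `n - 2` of both matrices starts with `(1, 0)`.
  · refine ⟨3, by decide, not_isOpposite_unipotent hn hn4 IsLastRows.sumRows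
      (isLastRows_single_zero F hn4) ⟨n - 2, by omega⟩
      (by simp only; omega) fun l hl => ?_⟩
    obtain ⟨m, rfl⟩ := hn
    simp only [sumRows, Matrix.of_apply, Matrix.single_apply, Fin.ext_iff, true_and]
    refine if_congr ?_ rfl rfl
    omega
  · refine ⟨0, by decide, not_isOpposite_unipotent hn hn4 (isLastRows_single_zero F hn4)
      IsLastRows.zero ⟨n - 1, by omega⟩
      (by simp only; omega) fun l _ => ?_⟩
    rw [Matrix.single_apply_of_row_ne hne]; rfl
  · refine ⟨0, by decide, not_isOpposite_unipotent hn hn4 (isLastRows_single_one F hn4)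
      IsLastRows.zero ⟨n - 1, by omega⟩
      (by simp only; omega) fun l _ => ?_⟩
    rw [Matrix.single_apply_of_row_ne hne]; rfl

end Base

/-! ### The bound on regular orbits -/

theorem theorem1p4 (q n : ℕ) (hq : q = 2 ∨ q = 3) (hn : Even n) (hn4 : 4 ≤ n)
    (F : Type*) [Field F] [Finite F] (hF : Nat.card F = q) :
    5 ≤ regOnCosets (flagNormalizer n F) 5 := by
  let := coreQuotientAction (flagNormalizer n F)
  have : Finite (GLTau n F) := Finite.of_equiv _ SemidirectProduct.equivProd.symm
  refine le_numRegularOrbits_of_unique (fun i => rowFlag (baseMatrix F hn4 i)) ?_ IsOpposite ?_ 1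
    (isOpposite_baseMatrix_one hn hn4) (exists_not_isOpposite_baseMatrix hn hn4)
  · rw [eq_bot_iff]
    intro g hg
    induction g using QuotientGroup.induction_on with
    | H g =>
      have hfix : ∀ i, g • rowFlag (baseMatrix F hn4 i) = rowFlag (baseMatrix F hn4 i) :=
        fun i => congrFun hg i
      rw [Subgroup.mem_bot, QuotientGroup.eq_one_iff]
      obtain ⟨A, t⟩ := g
      obtain rfl | rfl := eq_one_or_eq_tauGen t
      · exact inl_mem_normalCore (mem_center_of_fixes hn hn4 hfix)
      · exact (not_tauGen_fixes hn hn4 hfix).elim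
  · intro g a b hab
    induction g using QuotientGroup.induction_on with
    | H g => exact hab.smul g
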